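/- Lemma (prequantization on a symplectic manifold). Let $(M,\Omega)$ be a symplectic manifold of dimension $2n$ ($M$ Hausdorff and second countable, $\Omega$ a closed nondegenerate smooth 2-form) and let $\hbar>0$. For $f\in C^\infty(M,\mathbb{R})$ let $X_f$ be the Hamiltonian vector field, defined by $\Omega(X_f,\cdot)=-\mathrm{d}f$, and put $\{f,g\}:=\Omega(X_f,X_g)$. Let $L\to M$ be a smooth complex line bundle with a Hermitian metric $h$ and a connection $\nabla$, that is, a map $(X,s)\mapsto\nabla_Xs$ from $\Gamma(M,TM)\times\Gamma(M,L)$ to $\Gamma(M,L)$ which is $C^\infty(M,\mathbb{R})$-linear in $X$, $\mathbb{C}$-linear in $s$, and satisfies $\nabla_X(us)=X(u)s+u\nabla_Xs$ for all $u\in C^\infty(M,\mathbb{C})$. Suppose that $(L,\nabla,h)$ is a prequantum line bundle, i.e. its curvature $R^\nabla(X,Y):=\mathrm{i}\,(\nabla_X\nabla_Y-\nabla_Y\nabla_X-\nabla_{[X,Y]})$ satisfies $R^\nabla(X,Y)s=\frac1\hbar\Omega(X,Y)\,s$ for all vector fields $X,Y$ and all smooth sections $s$. For $f\in C^\infty(M,\mathbb{R})$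 let $\mathscr{Q}_{pre}(f):=-\mathrm{i}\hbar\nabla_{X_f}+f$, acting on $\Gamma(M,L)$. Then for all $f,g\in C^\infty(M,\mathbb{R})$ and every smooth section $s$ of $L$ that is square-integrable, i.e. $\int_M h(s,s)\,\frac{\Omega^{\wedge n}}{n!}<\infty$, $$\frac{\mathrm{i}}{\hbar}\,\big[\mathscr{Q}_{pre}(f),\mathscr{Q}_{pre}(g)\big]s=\mathscr{Q}_{pre}(\{f,g\})\,s ,$$ where $[A,B]=AB-BA$ is the commutator of operators on $\Gamma(M,L)$. -/

import Mathlib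

open scoped Manifold ContDiff Bundle

namespace Prequantization

/-- The model space `ℝ²ⁿ`. -/
abbrev ModelSpace (n : ℕ) : Type := EuclideanSpace ℝ (Fin (2 * n))

section Base

variable (n : ℕ) (M : Type*) [TopologicalSpace M] [ChartedSpace (ModelSpace n) M]

/-- `C^∞(M, ℝ)`. -/
abbrev SmoothFunction : Type _ := C^∞⟮𝓡 (2 * n), M; 𝓘(ℝ, ℝ), ℝ⟯

/-- `C^∞(M, ℂ)`. -/
abbrev ComplexSmoothFunction : Type _ := C^∞⟮𝓡 (2 * n), M; 𝓘(ℝ, ℂ), ℂ⟯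

/-- `Γ(M, TM)`. -/
abbrev SmoothVectorField [IsManifold (𝓡 (2 * n)) ∞ M] : Type _ :=
  Cₛ^∞⟮𝓡 (2 * n); ModelSpace n, (TangentSpace (𝓡 (2 * n)) : M → Type)⟯

variable {n M}

/-- A real smooth function as a complex-valued one. -/
noncomputable def SmoothFunction.toComplex (f : SmoothFunction n M) :
    ComplexSmoothFunction n M :=
  ⟨fun x => (f x : ℂ), Complex.ofRealCLM.contDiff.contMDiff.comp f.contMDiff⟩

variable [IsManifold (𝓡 (2 * n)) ∞ M]

/-- The vector field `f X`. -/
noncomputable def SmoothVectorField.smul (f : SmoothFunction n M) (X : SmoothVectorField n M) :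
    SmoothVectorField n M :=
  ⟨fun x => f x • X x, f.contMDiff.smul_section X.contMDiff⟩

/-- The Lie bracket `[X, Y] = XY - YX`. -/
noncomputable def SmoothVectorField.bracket (X Y : SmoothVectorField n M) :
    SmoothVectorField n M :=
  ⟨VectorField.mlieBracket (𝓡 (2 * n)) X Y, fun x =>
    haveI : IsManifold (𝓡 (2 * n)) (minSmoothness ℝ 2) M :=
      IsManifold.of_le (n := ∞) (by simpa using ENat.LEInfty.out)
    haveI : IsManifold (𝓡 (2 * n)) (((⊤ : ℕ∞) : ℕ∞ω) + 1) M :=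
      IsManifold.of_le (n := ∞) (by simp)
    ContMDiffAt.mlieBracket_vectorField (m := (⊤ : ℕ∞)) (n := (⊤ : ℕ∞)) (X.contMDiff x)
      (Y.contMDiff x) (by simp)⟩

variable (n M) in
/-- A symplectic form: a smooth, alternating, nondegenerate 2-form `Ω` with `dΩ = 0`, where
`dΩ(X, Y, Z) = X(Ω(Y, Z)) - Y(Ω(X, Z)) + Z(Ω(X, Y)) - Ω([X, Y], Z) + Ω([X, Z], Y) - Ω([Y, Z], X)`;
`mvfderiv I f x` is the differential `df` at `x`. -/
structure SymplecticForm where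
  toFun : ∀ x : M, TangentSpace (𝓡 (2 * n)) x →L[ℝ] TangentSpace (𝓡 (2 * n)) x →L[ℝ] ℝ
  contMDiff_toFun : ContMDiff (𝓡 (2 * n))
    ((𝓡 (2 * n)).prod 𝓘(ℝ, ModelSpace n →L[ℝ] ModelSpace n →L[ℝ] ℝ)) ∞
    (fun x => Bundle.TotalSpace.mk' (ModelSpace n →L[ℝ] ModelSpace n →L[ℝ] ℝ)
      (E := fun x : M => TangentSpace (𝓡 (2 * n)) x →L[ℝ] TangentSpace (𝓡 (2 * n)) x →L[ℝ] ℝ)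
      x (toFun x))
  alternating : ∀ (x : M) (v : TangentSpace (𝓡 (2 * n)) x), toFun x v v = 0
  nondegenerate : ∀ (x : M) (v : TangentSpace (𝓡 (2 * n)) x), (∀ w, toFun x v w = 0) → v = 0
  closed : ∀ (X Y Z : SmoothVectorField n M) (x : M),
    mvfderiv (𝓡 (2 * n)) (fun y => toFun y (Y y) (Z y)) x (X x)
      - mvfderiv (𝓡 (2 * n)) (fun y => toFun y (X y) (Z y)) x (Y x)
      + mvfderiv (𝓡 (2 * n)) (fun y => toFun y (X y) (Y y)) x (Z x)
      - toFun x (X.bracket Y x) (Z x)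
      + toFun x (X.bracket Z x) (Y x)
      - toFun x (Y.bracket Z x) (X x) = 0


/-- The differential of a smooth function is a smooth 1-form. -/
lemma contMDiff_mvfderiv (f : SmoothFunction n M) :
    ContMDiff (𝓡 (2 * n)) ((𝓡 (2 * n)).prod 𝓘(ℝ, ModelSpace n →L[ℝ] ℝ)) ∞
      (fun x => Bundle.TotalSpace.mk' (ModelSpace n →L[ℝ] ℝ)
        (E := fun x : M => TangentSpace (𝓡 (2 * n)) x →L[ℝ] ℝ) x
        (mvfderiv (𝓡 (2 * n)) f x)) := by
  intro x₀
  rw [contMDiffAt_hom_bundle]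
  refine ⟨contMDiffAt_id, ?_⟩
  have h := (f.contMDiff x₀).mfderiv_const (m := ∞) (by simp)
  refine h.congr_of_eventuallyEq (Filter.Eventually.of_forall fun x => ?_)
  ext v
  simp [inTangentCoordinates, ContinuousLinearMap.inCoordinates, mvfderiv]
  rfl

/-- By nondegeneracy, `v ↦ Ω(v, ·)` is an isomorphism from the tangent to the cotangent space. -/
lemma SymplecticForm.isInvertible (Ω : SymplecticForm n M) (x : M) :
    (Ω.toFun x).IsInvertible := by
  have : FiniteDimensional ℝ (TangentSpace (𝓡 (2 * n)) x) :=
    inferInstanceAs (FiniteDimensional ℝ (ModelSpace n))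
  have : T2Space (TangentSpace (𝓡 (2 * n)) x) := inferInstanceAs (T2Space (ModelSpace n))
  have hinj : Function.Injective (Ω.toFun x) := by
    rw [injective_iff_map_eq_zero]
    intro v hv
    exact Ω.nondegenerate x v fun w => by rw [hv]; rfl
  let φ : ModelSpace n →ₗ[ℝ] (ModelSpace n →L[ℝ] ℝ) := (Ω.toFun x).toLinearMap
  have hr : Module.finrank ℝ (ModelSpace n) = Module.finrank ℝ (ModelSpace n →L[ℝ] ℝ) := by
    rw [(LinearMap.toContinuousLinearMap (𝕜 := ℝ) (E := ModelSpace n) (F' := ℝ)).symm.finrank_eq]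
    exact Subspace.dual_finrank_eq.symm
  exact ⟨((LinearEquiv.ofInjectiveOfFinrankEq φ hinj hr).toContinuousLinearEquiv), rfl⟩

lemma SymplecticForm.contMDiff_inverse (Ω : SymplecticForm n M) (f : SmoothFunction n M) :
    ContMDiff (𝓡 (2 * n)) ((𝓡 (2 * n)).prod 𝓘(ℝ, ModelSpace n)) ∞
      (fun x => Bundle.TotalSpace.mk' (ModelSpace n) (E := TangentSpace (𝓡 (2 * n))) x
        ((Ω.toFun x).inverse (mvfderiv (𝓡 (2 * n)) f x))) := by
  intro x₀
  refine ContMDiffAt.clm_apply_of_inCoordinates (F₁ := ModelSpace n →L[ℝ] ℝ)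
    (E₁ := fun x : M => TangentSpace (𝓡 (2 * n)) x →L[ℝ] ℝ) (b₁ := id) (b₂ := id)
    (ϕ := fun x => (Ω.toFun x).inverse) ?_ (contMDiff_mvfderiv f x₀) contMDiffAt_id
  have h := Ω.contMDiff_toFun x₀
  rw [contMDiffAt_hom_bundle] at h
  have h2 := h.2
  set A : M → (ModelSpace n →L[ℝ] (ModelSpace n →L[ℝ] ℝ)) := fun x =>
    ContinuousLinearMap.inCoordinates (ModelSpace n) (TangentSpace (𝓡 (2 * n)) : M → Type)
      (ModelSpace n →L[ℝ] ℝ) (fun x : M => TangentSpace (𝓡 (2 * n)) x →L[ℝ] ℝ) x₀ x x₀ x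
      (Ω.toFun x) with hA
  have hev : ∀ᶠ x in nhds x₀,
      x ∈ (trivializationAt (ModelSpace n) (TangentSpace (𝓡 (2 * n)) : M → Type) x₀).baseSet ∧
      x ∈ (trivializationAt (ModelSpace n →L[ℝ] ℝ)
        (fun x : M => TangentSpace (𝓡 (2 * n)) x →L[ℝ] ℝ) x₀).baseSet :=
    Filter.inter_mem ((trivializationAt _ _ x₀).open_baseSet.mem_nhds
      (FiberBundle.mem_baseSet_trivializationAt' x₀)) ((trivializationAt _ _ x₀).open_baseSet.mem_nhds
      (FiberBundle.mem_baseSet_trivializationAt' x₀))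
  have hAinv : (A x₀).IsInvertible := by
    obtain ⟨h1, h2⟩ := hev.self_of_nhds
    rw [hA]; beta_reduce
    rw [ContinuousLinearMap.inCoordinates_eq h1 h2]
    obtain ⟨e, he⟩ := Ω.isInvertible x₀
    rw [← he]
    exact ⟨((ContinuousLinearEquiv.symm _).trans e).trans _, rfl⟩
  have h3 : ContMDiffAt (𝓡 (2 * n)) 𝓘(ℝ, (ModelSpace n →L[ℝ] ℝ) →L[ℝ] ModelSpace n) ∞
      (fun x => (A x).inverse) x₀ :=
    (hAinv.contDiffAt_map_inverse).contMDiffAt.comp x₀ h2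
  refine h3.congr_of_eventuallyEq ?_
  filter_upwards [hev] with x hx
  rw [hA]; beta_reduce
  rw [ContinuousLinearMap.inCoordinates_eq hx.1 hx.2]
  obtain ⟨e, he⟩ := Ω.isInvertible x
  rw [← he]
  simp only [id_eq]
  rw [ContinuousLinearMap.inCoordinates_eq hx.2 hx.1]
  simp
  rfl

/-- The Hamiltonian vector field `X_f`, i.e. the unique vector field with `Ω(X_f, ·) = -df`. -/
noncomputable def SymplecticForm.hamiltonianVectorField (Ω : SymplecticForm n M)
    (f : SmoothFunction n M) : SmoothVectorField n M :=
  -⟨fun x => (Ω.toFun x).inverse (mvfderiv (𝓡 (2 * n)) f x), Ω.contMDiff_inverse f⟩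

/-- The defining property of the Hamiltonian vector field. -/
lemma SymplecticForm.hamiltonianVectorField_spec (Ω : SymplecticForm n M)
    (f : SmoothFunction n M) (x : M) (v : TangentSpace (𝓡 (2 * n)) x) :
    Ω.toFun x (Ω.hamiltonianVectorField f x) v = -mvfderiv (𝓡 (2 * n)) f x v := by
  have h : Ω.hamiltonianVectorField f x
      = -(Ω.toFun x).inverse (mvfderiv (𝓡 (2 * n)) f x) := rfl
  obtain ⟨e, he⟩ := Ω.isInvertible x
  rw [h, map_neg, ← he, ContinuousLinearMap.inverse_equiv]
  simp

/-- The Poisson bracket `{f, g} = Ω(X_f, X_g)`. -/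
noncomputable def SymplecticForm.poissonBracket (Ω : SymplecticForm n M)
    (f g : SmoothFunction n M) : SmoothFunction n M :=
  ⟨fun x => Ω.toFun x (Ω.hamiltonianVectorField f x) (Ω.hamiltonianVectorField g x), by
    have h : ContMDiff (𝓡 (2 * n)) ((𝓡 (2 * n)).prod 𝓘(ℝ, ℝ)) ∞ (fun x =>
        Bundle.TotalSpace.mk' ℝ (E := Bundle.Trivial M ℝ) x (Ω.toFun x
          (Ω.hamiltonianVectorField f x) (Ω.hamiltonianVectorField g x))) :=
      ContMDiff.clm_bundle_apply₂ (F₁ := ModelSpace n) (F₂ := ModelSpace n)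
        Ω.contMDiff_toFun (Ω.hamiltonianVectorField f).contMDiff
        (Ω.hamiltonianVectorField g).contMDiff
    intro x
    have hx := h x
    simp only [Bundle.contMDiffAt_totalSpace] at hx
    exact hx.2⟩

/-- The Liouville volume form `λ = (1/n!) Ω ∧ ⋯ ∧ Ω` (`n` factors) evaluated on `2n` tangent
vectors at `x`, written out: the `n`-fold wedge power of `Ω` is
`2⁻ⁿ ∑_σ sign(σ) ∏_i Ω(v_{σ(2i)}, v_{σ(2i+1)})`. -/
noncomputable def SymplecticForm.liouvilleForm (Ω : SymplecticForm n M) (x : M)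
    (v : Fin (2 * n) → TangentSpace (𝓡 (2 * n)) x) : ℝ :=
  ((n.factorial : ℝ) * 2 ^ n)⁻¹ * ∑ σ : Equiv.Perm (Fin (2 * n)),
    ((Equiv.Perm.sign σ : ℤ) : ℝ) *
      ∏ i : Fin n, Ω.toFun x (v (σ ⟨2 * i, by omega⟩)) (v (σ ⟨2 * i + 1, by omega⟩))

/-- The measure of the Liouville volume form on the domain of the preferred chart `φ` at `p`,
extended by zero to `M`: the image under `φ⁻¹` of the measure on the target of `φ` with density
`|λ(∂₁, …, ∂₂ₙ)|`, where `∂ᵢ = d(φ⁻¹)(eᵢ)` are the coordinate vector fields of `φ`. -/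
noncomputable def SymplecticForm.chartLiouvilleMeasure [MeasurableSpace M]
    (Ω : SymplecticForm n M) (p : M) : MeasureTheory.Measure M :=
  MeasureTheory.Measure.map (chartAt (ModelSpace n) p).symm
    ((MeasureTheory.volume.restrict (chartAt (ModelSpace n) p).target).withDensity fun y =>
      ENNReal.ofReal |Ω.liouvilleForm ((chartAt (ModelSpace n) p).symm y) fun i =>
        mfderiv (𝓡 (2 * n)) (𝓡 (2 * n)) (chartAt (ModelSpace n) p).symm y
          (EuclideanSpace.single i (1 : ℝ) : ModelSpace n)|)

/-- The Liouville measure, i.e. integration against the volume form `λ = (1/n!) Ω ∧ ⋯ ∧ Ω` (`M` is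
oriented by `λ`). The chart measures agree on overlaps and countably many chart domains cover `M`,
so their supremum is the measure on `M` that restricts to each of them. -/
noncomputable def SymplecticForm.liouvilleMeasure [MeasurableSpace M]
    (Ω : SymplecticForm n M) : MeasureTheory.Measure M :=
  ⨆ p : M, Ω.chartLiouvilleMeasure p

end Base

section LineBundle

/- A smooth complex line bundle over `M` is a fiber bundle `L` with model fiber `ℂ`, complex linear
trivializations (`VectorBundle ℂ ℂ L`), and coordinate changes that are smooth over the real
manifold `M` (`ContMDiffVectorBundle ∞ ℂ L`, which refers to the underlying real bundle). -/
variable {n : ℕ} {M : Type*} [TopologicalSpace M] [ChartedSpace (ModelSpace n) M]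
  [IsManifold (𝓡 (2 * n)) ∞ M]
  (L : M → Type*) [∀ x, AddCommGroup (L x)] [∀ x, Module ℂ (L x)] [∀ x, TopologicalSpace (L x)]
  [TopologicalSpace (Bundle.TotalSpace ℂ L)] [FiberBundle ℂ L] [VectorBundle ℂ ℂ L]
  [VectorBundle ℝ ℂ L] [ContMDiffVectorBundle ∞ ℂ L (𝓡 (2 * n))]

variable (n) in
/-- The space `Γ(M, L)` of smooth sections of `L`. -/
abbrev SmoothSection : Type _ := Cₛ^∞⟮𝓡 (2 * n); ℂ, L⟯

variable {L}

lemma contMDiff_smul_section (g : ComplexSmoothFunction n M) (s : SmoothSection n L) :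
    ContMDiff (𝓡 (2 * n)) ((𝓡 (2 * n)).prod 𝓘(ℝ, ℂ)) ∞
      (fun x => Bundle.TotalSpace.mk' ℂ x (g x • s x)) := by
  intro x₀
  have hs := s.contMDiff x₀
  rw [Bundle.contMDiffAt_section] at hs ⊢
  set e := trivializationAt ℂ L x₀
  have hmul : ContMDiffAt (𝓡 (2 * n)) 𝓘(ℝ, ℂ) ∞ (fun x => g x * (e ⟨x, s x⟩).2) x₀ :=
    (contDiff_mul (𝕜 := ℝ) (𝔸 := ℂ) (n := ∞)).contMDiff.contMDiffAt.comp x₀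
      ((g.contMDiff x₀).prodMk_space hs)
  refine hmul.congr_of_eventuallyEq ?_
  filter_upwards [e.open_baseSet.mem_nhds (FiberBundle.mem_baseSet_trivializationAt' x₀)] with x hx
  exact (e.linear ℂ hx).map_smul (g x) (s x)

/-- Multiplication of sections by smooth complex functions. -/
noncomputable instance : SMul (ComplexSmoothFunction n M) (SmoothSection n L) :=
  ⟨fun g s => ⟨fun x => g x • s x, contMDiff_smul_section g s⟩⟩

noncomputable instance : SMul ℂ (SmoothSection n L) :=
  ⟨fun c s => ⟨fun x => c • s x, contMDiff_smul_section ⟨fun _ => c, contMDiff_const⟩ s⟩⟩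

/-- `Γ(M, L)` is a complex vector space, with the pointwise operations. -/
noncomputable instance : Module ℂ (SmoothSection n L) where
  one_smul s := ContMDiffSection.ext fun x => one_smul ℂ (s x)
  mul_smul a b s := ContMDiffSection.ext fun x => mul_smul a b (s x)
  smul_zero a := ContMDiffSection.ext fun _ => smul_zero a
  smul_add a s t := ContMDiffSection.ext fun x => smul_add a (s x) (t x)
  add_smul a b s := ContMDiffSection.ext fun x => add_smul a b (s x)
  zero_smul s := ContMDiffSection.ext fun x => zero_smul ℂ (s x)

/-- The operator on `Γ(M, L)` of multiplication by a real smooth function. -/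
noncomputable def mulOperator (f : SmoothFunction n M) : Module.End ℂ (SmoothSection n L) where
  toFun s := f.toComplex • s
  map_add' s t := ContMDiffSection.ext fun x => smul_add (f x : ℂ) (s x) (t x)
  map_smul' c s := ContMDiffSection.ext fun x => smul_comm (f x : ℂ) c (s x)

variable (n L) in
/-- A Hermitian metric on `L`: a smooth family of positive definite Hermitian forms on the fibers,
conjugate linear in the first argument. -/
structure HermitianMetric where
  toFun : ∀ x : M, L x →ₗ⋆[ℂ] L x →ₗ[ℂ] ℂ
  hermitian : ∀ (x : M) (v w : L x), (starRingEnd ℂ) (toFun x v w) = toFun x w v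
  pos : ∀ (x : M) (v : L x), v ≠ 0 → 0 < (toFun x v v).re
  smooth : ∀ s t : SmoothSection n L,
    ContMDiff (𝓡 (2 * n)) 𝓘(ℝ, ℂ) ∞ fun x => toFun x (s x) (t x)

variable (n L) in
/-- A connection on `L`; `toFun X s` is `∇_X s`. -/
structure Connection where
  toFun : SmoothVectorField n M → SmoothSection n L →ₗ[ℂ] SmoothSection n L
  map_add : ∀ (X Y : SmoothVectorField n M) (s : SmoothSection n L),
    toFun (X + Y) s = toFun X s + toFun Y s
  map_smul : ∀ (f : SmoothFunction n M) (X : SmoothVectorField n M) (s : SmoothSection n L),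
    toFun (X.smul f) s = f.toComplex • toFun X s
  leibniz : ∀ (X : SmoothVectorField n M) (g : ComplexSmoothFunction n M)
    (s : SmoothSection n L) (x : M),
    toFun X (g • s) x = mvfderiv (𝓡 (2 * n)) g x (X x) • s x + g x • toFun X s x

/-- The curvature `R(X, Y) = i (∇_X ∇_Y - ∇_Y ∇_X - ∇_{[X, Y]})`. -/
noncomputable def Connection.curvature (D : Connection n L) (X Y : SmoothVectorField n M) :
    Module.End ℂ (SmoothSection n L) :=
  Complex.I • (D.toFun X ∘ₗ D.toFun Y - D.toFun Y ∘ₗ D.toFun X - D.toFun (X.bracket Y))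

/-- The prequantum condition `R = Ω / ℏ`, where a function is identified with the endomorphism of
`L` that multiplies by it. -/
def Connection.IsPrequantum (D : Connection n L) (Ω : SymplecticForm n M) (hbar : ℝ) : Prop :=
  ∀ (X Y : SmoothVectorField n M) (s : SmoothSection n L) (x : M),
    D.curvature X Y s x = ((Ω.toFun x (X x) (Y x) / hbar : ℝ) : ℂ) • s x

/-- A smooth section `s` is square-integrable if the integral of `h(s, s)` against the Liouville
volume form is finite. -/
def HermitianMetric.IsSquareIntegrable [MeasurableSpace M] (h : HermitianMetric n L)
    (Ω : SymplecticForm n M) (s : SmoothSection n L) : Prop :=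
  ∫⁻ x, ENNReal.ofReal (h.toFun x (s x) (s x)).re ∂Ω.liouvilleMeasure < ⊤

/-- The prequantum operator `Q(f) = -i ℏ ∇_{X_f} + f` on `Γ(M, L)`. -/
noncomputable def prequantumOperator (Ω : SymplecticForm n M) (D : Connection n L) (hbar : ℝ)
    (f : SmoothFunction n M) : Module.End ℂ (SmoothSection n L) :=
  (-(Complex.I * hbar)) • D.toFun (Ω.hamiltonianVectorField f) + mulOperator f

end LineBundle

end Prequantization

namespace Prequantization

/-! ### Vector fields, Hamiltonian fields and the Poisson bracket. -/

section

variable {n : ℕ} {M : Type*} [TopologicalSpace M] [ChartedSpace (ModelSpace n) M]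

/-! Expand both products of operators with the Leibniz rule. In the commutator the terms with a
single `∇_{X_f}` or `∇_{X_g}` cancel, as does `fg`. What remains is `-ℏ²[∇_{X_f}, ∇_{X_g}] - iℏ(X_f
g - X_g f)`, and `X_f g - X_g f = 2{f, g}`. The curvature condition gives `[∇_{X_f}, ∇_{X_g}] =
∇_{[X_f, X_g]} - (i/ℏ){f, g}`, which contributes `+iℏ{f, g}`, so exactly one `-iℏ{f, g}` survives.
Multiplication by `i/ℏ` then yields `-iℏ∇_{[X_f, X_g]} + {f, g}`.

The geometric input is `[X_f, X_g] = X_{{f, g}}` (`SymplecticForm.bracket_hamiltonianVectorField`),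
which follows from closedness and nondegeneracy of `Ω`. It rests on the identity `[X, Y]f = X(Yf) -
Y(Xf)` (`SmoothFunction.mvfderiv_bracket`), transported from the model space through a chart, and on
the extension of tangent vectors to global fields. -/

lemma mvfderiv_toComplex (f : SmoothFunction n M) (x : M) (v : TangentSpace (𝓡 (2 * n)) x) :
    mvfderiv (𝓡 (2 * n)) f.toComplex x v = (mvfderiv (𝓡 (2 * n)) f x v : ℂ) := by
  have h := mfderiv_comp (I'' := 𝓘(ℝ, ℂ)) x (g := Complex.ofRealCLM)
    (Complex.ofRealCLM.differentiableAt.mdifferentiableAt)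
    (f.contMDiff.mdifferentiableAt (x := x) (by simp))
  have h2 : mfderiv (𝓡 (2 * n)) 𝓘(ℝ, ℂ) f.toComplex x = _ := h
  simp only [mvfderiv]
  rw [h2]
  rw [ContinuousLinearMap.mfderiv_eq]
  rfl

variable [IsManifold (𝓡 (2 * n)) ∞ M]

/-- Allows `Yf` to be differentiated again in the iterated derivatives `X(Yf)`. -/
lemma SmoothFunction.mdifferentiableAt_mvfderiv_apply (f : SmoothFunction n M)
    (X : SmoothVectorField n M) (x : M) :
    MDifferentiableAt (𝓡 (2 * n)) 𝓘(ℝ, ℝ) (fun y => mvfderiv (𝓡 (2 * n)) f y (X y)) x := by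
  have h : ContMDiff (𝓡 (2 * n)) ((𝓡 (2 * n)).prod 𝓘(ℝ, ℝ)) ∞ (fun x =>
      Bundle.TotalSpace.mk' ℝ (E := Bundle.Trivial M ℝ) x (mvfderiv (𝓡 (2 * n)) f x (X x))) :=
    ContMDiff.clm_bundle_apply (F₁ := ModelSpace n) (contMDiff_mvfderiv f) X.contMDiff
  have hx := h x
  simp only [Bundle.contMDiffAt_totalSpace] at hx
  exact hx.2.mdifferentiableAt (by simp)

/-- Chain rule: the derivative of `F` along a vector field, read in a chart, is the derivative of
the chart expression of `F` along the pulled back vector field. -/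
lemma fderiv_comp_extChartAt_symm_apply_mpullbackWithin {F : M → ℝ}
    (X : ∀ x : M, TangentSpace (𝓡 (2 * n)) x) {x : M} {u : ModelSpace n}
    (hu : u ∈ (extChartAt (𝓡 (2 * n)) x).target)
    (hF : MDifferentiableAt (𝓡 (2 * n)) 𝓘(ℝ, ℝ) F ((extChartAt (𝓡 (2 * n)) x).symm u)) :
    fderiv ℝ (F ∘ (extChartAt (𝓡 (2 * n)) x).symm) u
        (VectorField.mpullbackWithin 𝓘(ℝ, ModelSpace n) (𝓡 (2 * n))
          (extChartAt (𝓡 (2 * n)) x).symm X (Set.range (𝓡 (2 * n))) u)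
      = mvfderiv (𝓡 (2 * n)) F ((extChartAt (𝓡 (2 * n)) x).symm u)
          (X ((extChartAt (𝓡 (2 * n)) x).symm u)) := by
  have : IsManifold (𝓡 (2 * n)) 1 M := IsManifold.of_le (n := ∞) (by simp)
  -- The model has no boundary, so derivatives within the range are ordinary ones.
  have hr : Set.range (𝓡 (2 * n)) = Set.univ := by simp
  have hd : MDifferentiableAt 𝓘(ℝ, ModelSpace n) (𝓡 (2 * n))
      (extChartAt (𝓡 (2 * n)) x).symm u := by
    have := mdifferentiableWithinAt_extChartAt_symm hu
    rwa [hr, mdifferentiableWithinAt_univ] at this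
  have hinv := isInvertible_mfderivWithin_extChartAt_symm hu
  rw [VectorField.mpullbackWithin_apply]
  rw [hr, mfderivWithin_univ] at hinv ⊢
  rw [← mfderiv_eq_fderiv, mfderiv_comp u hF hd]
  -- The pullback applies the inverse of `d(φ⁻¹)`, and the chain rule applies `d(φ⁻¹)` again; the
  -- two cancel.
  obtain ⟨e, he⟩ := hinv
  rw [← he, ContinuousLinearMap.inverse_equiv]
  exact congrArg (mfderiv (𝓡 (2 * n)) 𝓘(ℝ, ℝ) F _) (e.apply_symm_apply _)

/-- The Lie bracket acts on functions as the commutator of the derivations. -/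
lemma SmoothFunction.mvfderiv_bracket (f : SmoothFunction n M) (X Y : SmoothVectorField n M)
    (x : M) :
    mvfderiv (𝓡 (2 * n)) f x (X.bracket Y x)
      = mvfderiv (𝓡 (2 * n)) (fun y => mvfderiv (𝓡 (2 * n)) f y (Y y)) x (X x)
        - mvfderiv (𝓡 (2 * n)) (fun y => mvfderiv (𝓡 (2 * n)) f y (X y)) x (Y x) := by
  have : IsManifold (𝓡 (2 * n)) 1 M := IsManifold.of_le (n := ∞) (by simp)
  have : IsManifold (𝓡 (2 * n)) 2 M :=
    IsManifold.of_le (n := ∞) (by simpa using ENat.LEInfty.out)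
  let φ := extChartAt (𝓡 (2 * n)) x
  have hset : φ.symm ⁻¹' Set.univ ∩ Set.range (𝓡 (2 * n)) = Set.univ := by simp
  let P (V : SmoothVectorField n M) : ModelSpace n → ModelSpace n :=
    VectorField.mpullbackWithin 𝓘(ℝ, ModelSpace n) (𝓡 (2 * n)) φ.symm V (Set.range (𝓡 (2 * n)))
  have hf (y : M) : MDifferentiableAt (𝓡 (2 * n)) 𝓘(ℝ, ℝ) f y :=
    f.contMDiff.mdifferentiableAt (by simp)
  have hP (V : SmoothVectorField n M) : DifferentiableAt ℝ (P V) (φ x) := by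
    have := MDifferentiableWithinAt.differentiableWithinAt_mpullbackWithin_vectorField
      (I := 𝓡 (2 * n)) (V := V) (s := Set.univ) (x := x)
      ((V.contMDiff x).mdifferentiableAt (by simp)).mdifferentiableWithinAt
    rw [hset] at this
    exact differentiableWithinAt_univ.1 this
  have hchain (F : M → ℝ) (hF : MDifferentiableAt (𝓡 (2 * n)) 𝓘(ℝ, ℝ) F x)
      (V : SmoothVectorField n M) :
      fderiv ℝ (F ∘ φ.symm) (φ x) (P V (φ x)) = mvfderiv (𝓡 (2 * n)) F x (V x) := by
    have := fderiv_comp_extChartAt_symm_apply_mpullbackWithin (F := F) V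
      (mem_extChartAt_target (I := 𝓡 (2 * n)) x) (by rwa [extChartAt_to_inv x])
    rw [extChartAt_to_inv x] at this
    exact this
  have hchain₂ (V W : SmoothVectorField n M) :
      fderiv ℝ (fun u => fderiv ℝ (f ∘ φ.symm) u (P V u)) (φ x) (P W (φ x))
        = mvfderiv (𝓡 (2 * n)) (fun y => mvfderiv (𝓡 (2 * n)) f y (V y)) x (W x) := by
    rw [← hchain _ (f.mdifferentiableAt_mvfderiv_apply V x) W]
    congr 1
    -- A second differentiation needs the chart formula for `Vf` on a neighbourhood, not just at the
    -- point; the chain rule holds on the whole chart target.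
    refine Filter.EventuallyEq.fderiv_eq ?_
    filter_upwards [extChartAt_target_mem_nhds (I := 𝓡 (2 * n)) x] with u hu
    exact fderiv_comp_extChartAt_symm_apply_mpullbackWithin V hu (hf _)
  have hfs : ContDiffAt ℝ ∞ (f ∘ φ.symm) (φ x) := by
    have h := (f.contMDiff.contMDiffAt (x := φ.symm (φ x))).comp (φ x)
      ((contMDiffOn_extChartAt_symm (I := 𝓡 (2 * n)) (n := ∞) x).contMDiffAt
        (extChartAt_target_mem_nhds (I := 𝓡 (2 * n)) x))
    exact h.contDiffAt
  -- The identity in the model space: the second derivatives of `f ∘ φ⁻¹` are symmetric and drop out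
  -- of the commutator.
  have hflat := VectorField.fderiv_apply_lieBracket hfs
    (by simpa using ENat.LEInfty.out) (hP Y) (hP X)
  rw [hchain₂, hchain₂] at hflat
  rw [← hflat]
  have hb : X.bracket Y x = (mfderiv (𝓡 (2 * n)) 𝓘(ℝ, ModelSpace n) φ x).inverse
      (VectorField.lieBracket ℝ (P X) (P Y) (φ x)) := by
    change VectorField.mlieBracketWithin (𝓡 (2 * n)) X Y Set.univ x = _
    rw [VectorField.mlieBracketWithin_apply, hset]
    exact congrArg _ (congrFun VectorField.lieBracketWithin_univ _)
  have hφ : MDifferentiableAt (𝓡 (2 * n)) 𝓘(ℝ, ModelSpace n) φ x :=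
    mdifferentiableAt_extChartAt (mem_chart_source _ x)
  -- Near `x`, `f = (f ∘ φ⁻¹) ∘ φ`; the factor `dφ` cancels the inverse of `dφ` in `hb`.
  have hdf : mfderiv (𝓡 (2 * n)) 𝓘(ℝ, ℝ) f x
      = (mfderiv 𝓘(ℝ, ModelSpace n) 𝓘(ℝ, ℝ) (f ∘ φ.symm) (φ x)).comp
        (mfderiv (𝓡 (2 * n)) 𝓘(ℝ, ModelSpace n) φ x) := by
    rw [← mfderiv_comp x (hfs.differentiableAt (by simp)).mdifferentiableAt hφ]
    refine Filter.EventuallyEq.mfderiv_eq ?_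
    filter_upwards [extChartAt_source_mem_nhds (I := 𝓡 (2 * n)) x] with y hy
    exact congrArg f ((extChartAt (𝓡 (2 * n)) x).left_inv hy).symm
  obtain ⟨e, he⟩ := isInvertible_mfderiv_extChartAt (mem_extChartAt_source (I := 𝓡 (2 * n)) x)
  rw [hb, ← he, ContinuousLinearMap.inverse_equiv]
  simp only [mvfderiv]
  rw [hdf, ← he, mfderiv_eq_fderiv]
  exact congrArg (fderiv ℝ (f ∘ φ.symm) (φ x)) (e.apply_symm_apply _)

/-- Every tangent vector extends to a smooth vector field. -/
lemma SmoothVectorField.exists_apply_eq [T2Space M] (x : M) (v : TangentSpace (𝓡 (2 * n)) x) :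
    ∃ X : SmoothVectorField n M, X x = v := by
  obtain ⟨s, hs, hσ⟩ := FiberBundle.exists_contMDiffOn_extend (k := ∞) (𝓡 (2 * n)) (ModelSpace n) v
  obtain ⟨t, hts, ht, hxt⟩ := mem_nhds_iff.1 hs
  -- The local extension is cut off by a bump function supported where it is smooth; its value 1 at
  -- `x` preserves `v`.
  obtain ⟨b, -, hb⟩ := (SmoothBumpFunction.nhds_basis_tsupport (I := 𝓡 (2 * n)) x).mem_iff.1
    (ht.mem_nhds hxt)
  refine ⟨⟨_, ContMDiffOn.smul_section_of_tsupport b.contMDiff.contMDiffOn ht hb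
    (hσ.mono hts)⟩, ?_⟩
  change b x • FiberBundle.extend (ModelSpace n) v x = v
  simp

variable (Ω : SymplecticForm n M)

lemma SymplecticForm.swap (x : M) (v w : TangentSpace (𝓡 (2 * n)) x) :
    Ω.toFun x v w = -Ω.toFun x w v := by
  have h := Ω.alternating x (v + w)
  simp only [map_add, add_apply, Ω.alternating] at h
  linarith

lemma SymplecticForm.apply_hamiltonianVectorField_right (f : SmoothFunction n M) (x : M)
    (v : TangentSpace (𝓡 (2 * n)) x) :
    Ω.toFun x v (Ω.hamiltonianVectorField f x) = mvfderiv (𝓡 (2 * n)) f x v := by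
  rw [Ω.swap, Ω.hamiltonianVectorField_spec, neg_neg]

lemma SymplecticForm.poissonBracket_apply (f g : SmoothFunction n M) (x : M) :
    Ω.poissonBracket f g x = mvfderiv (𝓡 (2 * n)) g x (Ω.hamiltonianVectorField f x) :=
  Ω.apply_hamiltonianVectorField_right g x _

lemma SymplecticForm.poissonBracket_swap_apply (f g : SmoothFunction n M) (x : M) :
    Ω.poissonBracket f g x = -Ω.poissonBracket g f x :=
  Ω.swap x _ _

/-- The Hamiltonian vector field of a Poisson bracket is the Lie bracket of the Hamiltonian
vector fields. -/
lemma SymplecticForm.bracket_hamiltonianVectorField [T2Space M] (f g : SmoothFunction n M) :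
    (Ω.hamiltonianVectorField f).bracket (Ω.hamiltonianVectorField g)
      = Ω.hamiltonianVectorField (Ω.poissonBracket f g) := by
  refine ContMDiffSection.ext fun x => ?_
  rw [← sub_eq_zero]
  refine Ω.nondegenerate x _ fun w => ?_
  -- Closedness is expressed through vector fields, so the test vector must be extended.
  obtain ⟨Z, rfl⟩ := SmoothVectorField.exists_apply_eq x w
  have h := Ω.closed (Ω.hamiltonianVectorField f) (Ω.hamiltonianVectorField g) Z x
  -- The terms `X_f(Zg)` and `X_g(Zf)` each occur with both signs. Of the multiples of `Z{f, g}`,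
  -- one comes from `Z(Ω(X_f, X_g))` and two negative ones from the brackets with `Z`, leaving
  -- `Ω([X_f, X_g], Z) = -Z{f, g}`.
  simp only [Ω.hamiltonianVectorField_spec, Ω.apply_hamiltonianVectorField_right,
    mvfderiv_fun_neg, ← Ω.poissonBracket_apply, SmoothFunction.mvfderiv_bracket] at h
  have hneg : mvfderiv (𝓡 (2 * n)) (Ω.poissonBracket g f) x (Z x)
      = -mvfderiv (𝓡 (2 * n)) (Ω.poissonBracket f g) x (Z x) := by
    rw [show (Ω.poissonBracket g f : M → ℝ) = fun y => -Ω.poissonBracket f g y from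
      funext (Ω.poissonBracket_swap_apply g f), mvfderiv_fun_neg]
    rfl
  rw [map_sub, sub_apply, Ω.hamiltonianVectorField_spec]
  simp only [neg_apply] at h
  linarith

end

/-! ### Connections and prequantum operators on sections. -/

section

variable {n : ℕ} {M : Type*} [TopologicalSpace M] [ChartedSpace (ModelSpace n) M]
  [IsManifold (𝓡 (2 * n)) ∞ M]
  {L : M → Type*} [∀ x, AddCommGroup (L x)] [∀ x, Module ℂ (L x)] [∀ x, TopologicalSpace (L x)]
  [TopologicalSpace (Bundle.TotalSpace ℂ L)] [FiberBundle ℂ L] [VectorBundle ℂ ℂ L]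
  [VectorBundle ℝ ℂ L] [ContMDiffVectorBundle ∞ ℂ L (𝓡 (2 * n))]

lemma Connection.toFun_mulOperator_apply (D : Connection n L) (X : SmoothVectorField n M)
    (f : SmoothFunction n M) (s : SmoothSection n L) (x : M) :
    D.toFun X (mulOperator f s) x
      = ((mvfderiv (𝓡 (2 * n)) f x (X x) : ℝ) : ℂ) • s x + (f x : ℂ) • D.toFun X s x := by
  rw [← mvfderiv_toComplex]
  exact D.leibniz X f.toComplex s x

lemma prequantumOperator_apply (Ω : SymplecticForm n M) (D : Connection n L) (hbar : ℝ)
    (f : SmoothFunction n M) (s : SmoothSection n L) (x : M) :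
    prequantumOperator Ω D hbar f s x
      = (-(Complex.I * hbar)) • D.toFun (Ω.hamiltonianVectorField f) s x + (f x : ℂ) • s x :=
  rfl

/-- The curvature condition multiplied by `-i`, which removes the factor `i` in the curvature, and
solved for `∇_X ∇_Y s` so that it can serve as a rewrite rule. -/
lemma Connection.IsPrequantum.commutator_apply {D : Connection n L} {Ω : SymplecticForm n M}
    {hbar : ℝ} (hD : D.IsPrequantum Ω hbar) (X Y : SmoothVectorField n M)
    (s : SmoothSection n L) (x : M) :
    D.toFun X (D.toFun Y s) x = D.toFun Y (D.toFun X s) x + D.toFun (X.bracket Y) s x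
      + (-Complex.I * (Ω.toFun x (X x) (Y x) / hbar : ℝ)) • s x := by
  have h : Complex.I • (D.toFun X (D.toFun Y s) x - D.toFun Y (D.toFun X s) x
      - D.toFun (X.bracket Y) s x) = _ := hD X Y s x
  have h2 := congrArg (fun v => (-Complex.I) • v) h
  simp only [smul_smul, neg_mul, Complex.I_mul_I, neg_neg, one_smul] at h2
  rw [neg_mul, ← h2]
  abel

end

end Prequantization

theorem mainTheorem8 {n : ℕ} {M : Type*} [TopologicalSpace M] [T2Space M]
    [SecondCountableTopology M] [ChartedSpace (Prequantization.ModelSpace n) M]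
    [IsManifold (𝓡 (2 * n)) ∞ M] [MeasurableSpace M] [BorelSpace M]
    {L : M → Type*} [∀ x, AddCommGroup (L x)] [∀ x, Module ℂ (L x)]
    [∀ x, TopologicalSpace (L x)] [TopologicalSpace (Bundle.TotalSpace ℂ L)] [FiberBundle ℂ L]
    [VectorBundle ℂ ℂ L] [VectorBundle ℝ ℂ L] [ContMDiffVectorBundle ∞ ℂ L (𝓡 (2 * n))]
    (Ω : Prequantization.SymplecticForm n M) (h : Prequantization.HermitianMetric n L)
    (D : Prequantization.Connection n L) (hbar : ℝ) (hbar_pos : 0 < hbar)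
    (hD : D.IsPrequantum Ω hbar) (f g : Prequantization.SmoothFunction n M)
    (s : Prequantization.SmoothSection n L) (hs : h.IsSquareIntegrable Ω s) :
    (Complex.I / hbar) • ⁅Prequantization.prequantumOperator Ω D hbar f,
        Prequantization.prequantumOperator Ω D hbar g⁆ s
      = Prequantization.prequantumOperator Ω D hbar (Ω.poissonBracket f g) s := by
  open Prequantization in
  have hb : (hbar : ℂ) ≠ 0 := by exact_mod_cast hbar_pos.ne'
  refine ContMDiffSection.ext fun x => ?_
  -- The Leibniz term is `X_f g = {f, g}`. The statement is quantified anew over `f` and `g` so that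
  -- it covers both orders of the product.
  have hQ (f g : SmoothFunction n M) :
      prequantumOperator Ω D hbar f (prequantumOperator Ω D hbar g s) x
        = (-(Complex.I * hbar)) • ((-(Complex.I * hbar)) • D.toFun (Ω.hamiltonianVectorField f)
              (D.toFun (Ω.hamiltonianVectorField g) s) x
            + ((Ω.poissonBracket f g x : ℂ) • s x
              + (g x : ℂ) • D.toFun (Ω.hamiltonianVectorField f) s x))
          + (f x : ℂ) • ((-(Complex.I * hbar)) • D.toFun (Ω.hamiltonianVectorField g) s x
            + (g x : ℂ) • s x) := by
    rw [Ω.poissonBracket_apply, ← D.toFun_mulOperator_apply, prequantumOperator_apply,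
      prequantumOperator_apply]
    congr 2
    simp only [prequantumOperator, LinearMap.add_apply, LinearMap.smul_apply, map_add, map_smul]
    rfl
  have hc := hD.commutator_apply (Ω.hamiltonianVectorField f) (Ω.hamiltonianVectorField g) s x
  rw [Ω.bracket_hamiltonianVectorField] at hc
  change (Complex.I / hbar : ℂ) • (prequantumOperator Ω D hbar f (prequantumOperator Ω D hbar g s) x
    - prequantumOperator Ω D hbar g (prequantumOperator Ω D hbar f s) x) = _
  rw [hQ, hQ, hc, prequantumOperator_apply, Ω.poissonBracket_swap_apply g f,
    show Ω.toFun x (Ω.hamiltonianVectorField f x) (Ω.hamiltonianVectorField g x)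
      = Ω.poissonBracket f g x from rfl]
  push_cast
  -- Everything is now a combination of `s`, `∇_{X_f} s`, `∇_{X_g} s`, `∇_{X_g} ∇_{X_f} s` and
  -- `∇_{X_{{f, g}}} s`; the coefficients agree by `i² = -1` and `ℏ ≠ 0`.
  match_scalars
  all_goals have := Complex.I_sq
  all_goals grind
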